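/- Let $c>0$ and $\beta\in(0,2)$, and let $k:\mathbb{Z}\to[0,\infty)$ be the power type kernel $k(j)=c\,|j|^{-(1+\beta)}$ for $j\in\mathbb{Z}\setminus\{0\}$, $k(0)=0$. For bounded $u,v:\mathbb{Z}\to\mathbb{R}$ and $x\in\mathbb{Z}$ put $$\mathcal{L}v(x)=\sum_{j\in\mathbb{Z}}k(j)\big(v(x+j)-v(x)\big),\qquad \Gamma(u,v)=\tfrac12\big(\mathcal{L}(uv)-u\,\mathcal{L}v-v\,\mathcal{L}u\big),$$ $$\Gamma_2(u,v)=\tfrac12\big(\mathcal{L}\Gamma(u,v)-\Gamma(u,\mathcal{L}v)-\Gamma(\mathcal{L}u,v)\big),\qquad \Gamma_2(v)=\Gamma_2(v,v).$$ Then there exists no finite $d>0$ such that $$\Gamma_2(v)(0)\ \ge\ \frac1d\,\big((\mathcal{L}v)(0)\big)^2$$ holds for all compactly (that is, finitely) supported functions $v:\mathbb{Z}\to\mathbb{R}$. -/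

import Mathlib

noncomputable section

namespace NonlocalCD

/-- The non-local operator `(𝓛 v)(x) = ∑_{j ∈ ℤ} k(j) (v(x + j) - v(x))` on the lattice `ℤ`.
For a summable kernel `k` the series converges absolutely whenever `v` is bounded. -/
def nonlocalOp (k : ℤ → ℝ) (v : ℤ → ℝ) (x : ℤ) : ℝ :=
  ∑' j : ℤ, k j * (v (x + j) - v x)

/-- The power type kernel: `k(j) = c / |j| ^ (1 + β)` for `j ≠ 0`, and `k(0) = 0`. -/
def powerKernel (c β : ℝ) (j : ℤ) : ℝ :=
  if j = 0 then 0 else c / |(j : ℝ)| ^ (1 + β)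

/-- The carré du champ operator
`Γ(u, v) = (1/2) (𝓛(u v) - u 𝓛 v - v 𝓛 u)` of an operator `L` on functions on `ℤ`. -/
def carreDuChamp (L : (ℤ → ℝ) → ℤ → ℝ) (u v : ℤ → ℝ) : ℤ → ℝ :=
  fun x => (1 / 2) * (L (fun y => u y * v y) x - u x * L v x - v x * L u x)

/-- The iterated carré du champ operator
`Γ₂(u, v) = (1/2) (𝓛 Γ(u, v) - Γ(u, 𝓛 v) - Γ(𝓛 u, v))`. -/
def iteratedCarreDuChamp (L : (ℤ → ℝ) → ℤ → ℝ) (u v : ℤ → ℝ) : ℤ → ℝ :=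
  fun x => (1 / 2) *
    (L (carreDuChamp L u v) x - carreDuChamp L u (L v) x - carreDuChamp L (L u) v x)

end NonlocalCD

end

/-!
The operator `𝓛` is translation invariant, so `Γ₂(v)(0)` is a weighted sum of squared second
differences, `1/4 ∑ k(j) k(l) (v(j + l) - v(j) - v(l) + v(0)) ^ 2`
(`iteratedCarreDuChamp_nonlocalOp`). The inequality is tested on the truncated powers
`v(x) = min(|x|, N) ^ β - N ^ β` (`truncPow`). They are finitely supported, and subtracting the
constant `N ^ β` changes neither `𝓛 v` nor `Γ₂(v)`.

The exponent `β` is critical for the kernel: `𝓛 v(0) = ∑ k(j) min(|j|, N) ^ β` dominates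
`c ∑_{n ≤ N} 1 / n` and so tends to infinity with `N` (`harmonic_le_nonlocalOp_truncPow`).

On the other hand `Γ₂(v)(0) ≤ K 𝓛 v(0)` with `K` independent of `N`
(`exists_iteratedCarreDuChamp_truncPow_le`). Indeed, write `m(x) = min(|x|, N)`. For `|l| ≤ |j|`
and `s = min(1, β)`, the second difference is at most a constant times `m(l) ^ s m(j) ^ (β - s)`
(`abs_rpow_sub_rpow_sub_rpow_le`). As `β < 2`, one has `2 s > β`, so the sum
`∑_{|l| ≤ |j|} k(l) m(l) ^ (2 s)` is at most a constant times `m(j) ^ (2 s - β)`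
(`sum_range_rpow_mul_min_rpow_le`). Summing over `l` first thus leaves a constant times
`∑ k(j) m(j) ^ β`, which is `𝓛 v(0)` again.

Consequently `Γ₂(v)(0) ≥ (𝓛 v(0)) ^ 2 / d` would force `𝓛 v(0) ≤ d K` for all `N`.
-/

/-! ### Bounded functions and summable kernels -/

/-- Boundedness of a real-valued function on an arbitrary index type. -/
def IsBoundedFun {ι : Type*} (f : ι → ℝ) : Prop := ∃ C, ∀ i, |f i| ≤ C

namespace IsBoundedFun

variable {ι κ : Type*} {f g : ι → ℝ}

lemma comp (hf : IsBoundedFun f) (e : κ → ι) : IsBoundedFun fun i => f (e i) :=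
  hf.imp fun _ hC i => hC (e i)

lemma sub (hf : IsBoundedFun f) (hg : IsBoundedFun g) : IsBoundedFun fun i => f i - g i := by
  obtain ⟨A, hA⟩ := hf
  obtain ⟨B, hB⟩ := hg
  exact ⟨A + B, fun i => (abs_sub _ _).trans (add_le_add (hA i) (hB i))⟩

lemma mul (hf : IsBoundedFun f) (hg : IsBoundedFun g) : IsBoundedFun fun i => f i * g i := by
  obtain ⟨A, hA⟩ := hf
  obtain ⟨B, hB⟩ := hg
  refine ⟨A * B, fun i => ?_⟩
  rw [abs_mul]
  exact mul_le_mul (hA i) (hB i) (abs_nonneg _) ((abs_nonneg _).trans (hA i))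

lemma const (a : ℝ) : IsBoundedFun fun _ : ι => a := ⟨|a|, fun _ => le_rfl⟩

lemma summable_mul (hf : IsBoundedFun f) {k : ι → ℝ} (hk : Summable k) :
    Summable fun i => k i * f i := by
  obtain ⟨C, hC⟩ := hf
  refine Summable.of_norm_bounded (hk.abs.mul_right C) fun i => ?_
  rw [Real.norm_eq_abs, abs_mul]
  exact mul_le_mul_of_nonneg_left (hC i) (abs_nonneg _)

lemma tsum_mul {k : κ → ℝ} {F : ι → κ → ℝ}
    (hF : ∃ C, ∀ i j, |F i j| ≤ C) (hk : Summable k) :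
    IsBoundedFun fun i => ∑' j, k j * F i j := by
  obtain ⟨C, hC⟩ := hF
  refine ⟨∑' j, |k j| * C, fun i => ?_⟩
  have h : ∀ j, ‖k j * F i j‖ ≤ |k j| * C := fun j => by
    rw [Real.norm_eq_abs, abs_mul]
    exact mul_le_mul_of_nonneg_left (hC i j) (abs_nonneg _)
  exact tsum_of_norm_bounded (hk.abs.mul_right C).hasSum h

end IsBoundedFun

lemma Summable.mul_self_prod {ι : Type*} {k : ι → ℝ} (hk : Summable k) :
    Summable fun p : ι × ι => k p.1 * k p.2 :=
  summable_mul_of_summable_norm hk.norm hk.norm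

/-! ### The double sum for the iterated carré du champ -/

namespace NonlocalCD

variable {k u v : ℤ → ℝ}

lemma isBoundedFun_nonlocalOp (hk : Summable k) (hv : IsBoundedFun v) :
    IsBoundedFun (nonlocalOp k v) := by
  refine IsBoundedFun.tsum_mul ?_ hk
  obtain ⟨C, hC⟩ := (hv.comp fun p : ℤ × ℤ => p.1 + p.2).sub (hv.comp Prod.fst)
  exact ⟨C, fun i j => hC (i, j)⟩

lemma summable_kernel_diff (hk : Summable k) (hv : IsBoundedFun v) (x y : ℤ) :
    Summable fun j => k j * (v (y + j) - v x) :=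
  ((hv.comp fun j => y + j).sub (.const _)).summable_mul hk

lemma carreDuChamp_nonlocalOp (hk : Summable k) (hu : IsBoundedFun u) (hv : IsBoundedFun v)
    (x : ℤ) :
    carreDuChamp (nonlocalOp k) u v x =
      1 / 2 * ∑' j, k j * ((u (x + j) - u x) * (v (x + j) - v x)) := by
  unfold carreDuChamp
  congr 1
  have h1 := summable_kernel_diff hk (hu.mul hv) x x
  have h2 := (summable_kernel_diff hk hv x x).mul_left (u x)
  have h3 := (summable_kernel_diff hk hu x x).mul_left (v x)
  unfold nonlocalOp
  rw [← tsum_mul_left, ← tsum_mul_left, ← h1.tsum_sub h2, ← (h1.sub h2).tsum_sub h3]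
  exact tsum_congr fun j => by ring

/-- The second difference of `v` at `x` in the directions `j` and `l`. -/
def secondDiff (v : ℤ → ℝ) (x j l : ℤ) : ℝ := v (x + j + l) - v (x + j) - v (x + l) + v x

lemma secondDiff_comm (v : ℤ → ℝ) (x j l : ℤ) : secondDiff v x j l = secondDiff v x l j := by
  unfold secondDiff
  rw [add_right_comm x j l]
  ring

lemma isBoundedFun_secondDiff (hv : IsBoundedFun v) (x : ℤ) :
    IsBoundedFun fun p : ℤ × ℤ => secondDiff v x p.1 p.2 := by
  have := ((hv.comp fun p : ℤ × ℤ => x + p.1 + p.2).sub (hv.comp fun p : ℤ × ℤ => x + p.1)).sub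
    ((hv.comp fun p : ℤ × ℤ => x + p.2).sub (.const (v x)))
  convert this using 2
  unfold secondDiff
  ring

lemma nonlocalOp_sub_nonlocalOp (hk : Summable k) (hv : IsBoundedFun v) (x j : ℤ) :
    nonlocalOp k v (x + j) - nonlocalOp k v x = ∑' l, k l * secondDiff v x j l := by
  unfold nonlocalOp secondDiff
  rw [← (summable_kernel_diff hk hv _ _).tsum_sub (summable_kernel_diff hk hv _ _)]
  exact tsum_congr fun l => by ring

lemma carreDuChamp_nonlocalOp_right (hk : Summable k) (hv : IsBoundedFun v) (x : ℤ) :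
    carreDuChamp (nonlocalOp k) v (nonlocalOp k v) x =
      1 / 2 * ∑' p : ℤ × ℤ, k p.1 * k p.2 * ((v (x + p.1) - v x) * secondDiff v x p.1 p.2) := by
  rw [carreDuChamp_nonlocalOp hk hv (isBoundedFun_nonlocalOp hk hv)]
  congr 1
  have hs := (((hv.comp fun p : ℤ × ℤ => x + p.1).sub (.const (v x))).mul
    (isBoundedFun_secondDiff hv x)).summable_mul hk.mul_self_prod
  rw [hs.tsum_prod]
  refine tsum_congr fun j => ?_
  rw [nonlocalOp_sub_nonlocalOp hk hv, ← tsum_mul_left, ← tsum_mul_left]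
  exact tsum_congr fun l => by ring

lemma nonlocalOp_carreDuChamp (hk : Summable k) (hv : IsBoundedFun v) (x : ℤ) :
    nonlocalOp k (carreDuChamp (nonlocalOp k) v v) x =
      1 / 2 * ∑' p : ℤ × ℤ, k p.1 * k p.2 *
        (secondDiff v x p.1 p.2 ^ 2 + 2 * ((v (x + p.2) - v x) * secondDiff v x p.1 p.2)) := by
  have hb : IsBoundedFun fun p : ℤ × ℤ =>
      secondDiff v x p.1 p.2 ^ 2 + 2 * ((v (x + p.2) - v x) * secondDiff v x p.1 p.2) := by
    have h1 := (hv.comp fun p : ℤ × ℤ => x + p.1 + p.2).sub (hv.comp fun p : ℤ × ℤ => x + p.1)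
    have h2 := (hv.comp fun p : ℤ × ℤ => x + p.2).sub (.const (v x))
    convert (h1.mul h1).sub (h2.mul h2) using 2
    unfold secondDiff
    ring
  rw [(hb.summable_mul hk.mul_self_prod).tsum_prod, ← tsum_mul_left]
  refine tsum_congr fun j => ?_
  have hsq : ∀ y, Summable fun l => k l * ((v (y + l) - v y) * (v (y + l) - v y)) := fun y =>
    (((hv.comp fun l => y + l).sub (.const _)).mul
      ((hv.comp fun l => y + l).sub (.const _))).summable_mul hk
  rw [carreDuChamp_nonlocalOp hk hv hv, carreDuChamp_nonlocalOp hk hv hv, ← mul_sub,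
    ← (hsq _).tsum_sub (hsq _), mul_left_comm, ← tsum_mul_left]
  congr 1
  refine tsum_congr fun l => ?_
  unfold secondDiff
  ring

/-- For a translation invariant operator, `Γ₂(v)` is a weighted sum of squared second
differences. No symmetry of the kernel is needed. -/
theorem iteratedCarreDuChamp_nonlocalOp (hk : Summable k) (hv : IsBoundedFun v) (x : ℤ) :
    iteratedCarreDuChamp (nonlocalOp k) v v x =
      1 / 4 * ∑' p : ℤ × ℤ, k p.1 * k p.2 * secondDiff v x p.1 p.2 ^ 2 := by
  have hcomm : carreDuChamp (nonlocalOp k) (nonlocalOp k v) v x =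
      carreDuChamp (nonlocalOp k) v (nonlocalOp k v) x := by
    unfold carreDuChamp
    simp only [mul_comm (nonlocalOp k v _) (v _)]
    ring
  -- Exchanging the two directions turns the mixed term of `𝓛 Γ(v)` into that of `Γ(v, 𝓛 v)`.
  have hswap : ∑' p : ℤ × ℤ, k p.1 * k p.2 * ((v (x + p.2) - v x) * secondDiff v x p.1 p.2) =
      ∑' p : ℤ × ℤ, k p.1 * k p.2 * ((v (x + p.1) - v x) * secondDiff v x p.1 p.2) := by
    rw [← (Equiv.prodComm ℤ ℤ).tsum_eq]
    refine tsum_congr fun p => ?_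
    simp only [Equiv.prodComm_apply, Prod.fst_swap, Prod.snd_swap, secondDiff_comm v x p.2 p.1]
    ring
  have hD := isBoundedFun_secondDiff hv x
  have h1 := (hD.mul hD).summable_mul hk.mul_self_prod
  have h2 := ((((hv.comp fun p : ℤ × ℤ => x + p.2).sub (.const (v x))).mul hD).summable_mul
    hk.mul_self_prod).mul_left 2
  have hsplit : ∑' p : ℤ × ℤ, k p.1 * k p.2 *
        (secondDiff v x p.1 p.2 ^ 2 + 2 * ((v (x + p.2) - v x) * secondDiff v x p.1 p.2)) =
      ∑' p : ℤ × ℤ, k p.1 * k p.2 * secondDiff v x p.1 p.2 ^ 2 +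
      2 * ∑' p : ℤ × ℤ, k p.1 * k p.2 * ((v (x + p.2) - v x) * secondDiff v x p.1 p.2) := by
    rw [← tsum_mul_left]
    simp only [pow_two]
    rw [← h1.tsum_add h2]
    exact tsum_congr fun p => by ring
  unfold iteratedCarreDuChamp
  rw [hcomm, nonlocalOp_carreDuChamp hk hv, carreDuChamp_nonlocalOp_right hk hv, hsplit, hswap]
  ring

end NonlocalCD

/-! ### Power functions -/

lemma rpow_sub_rpow_le {β x M : ℝ} (hβ0 : 0 < β) (hβ2 : β ≤ 2) (hx : 0 ≤ x) (hxM : x ≤ M)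
    (hM : 0 < M) : M ^ β - x ^ β ≤ 2 * (M ^ β / M) * (M - x) := by
  have ht0 : 0 ≤ x / M := by positivity
  have ht1 : x / M ≤ 1 := (div_le_one hM).2 hxM
  -- As `β ≤ 2`, `1 - t ^ β ≤ 1 - t ^ 2 ≤ 2 (1 - t)` for `t = x / M`.
  have h : (x / M) ^ 2 ≤ (x / M) ^ β := by
    rcases ht0.eq_or_lt with h0 | h0
    · rw [← h0, Real.zero_rpow hβ0.ne']; norm_num
    · rw [← Real.rpow_natCast]
      exact Real.rpow_le_rpow_of_exponent_ge h0 ht1 (by exact_mod_cast hβ2)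
  have hx' : x ^ β = M ^ β * (x / M) ^ β := by
    rw [← Real.mul_rpow hM.le ht0, mul_div_cancel₀ _ hM.ne']
  have hMx : 2 * (M ^ β / M) * (M - x) = M ^ β * (2 * (1 - x / M)) := by
    field_simp
  rw [hx', hMx]
  have hMβ : 0 ≤ M ^ β := by positivity
  nlinarith [mul_le_mul_of_nonneg_left h hMβ, mul_nonneg hMβ (sq_nonneg (1 - x / M))]

/-- If `y` lies within distance `a ≤ m` of `m`, then both `y ^ β - m ^ β`, of order
`a m ^ (β - 1)` by the mean value theorem, and `a ^ β` are dominated by `a ^ s m ^ (β - s)` as soon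
as `s ≤ min 1 β`. -/
lemma abs_rpow_sub_rpow_sub_rpow_le {β s a m y : ℝ} (hβ0 : 0 < β) (hβ2 : β ≤ 2) (hs1 : s ≤ 1)
    (hsβ : s ≤ β) (ha : 0 < a) (ham : a ≤ m) (hy : 0 ≤ y) (hym : |y - m| ≤ a) :
    |y ^ β - m ^ β - a ^ β| ≤ 9 * (a ^ s * m ^ (β - s)) := by
  have hm : 0 < m := ha.trans_le ham
  -- The larger of `y` and `m` lies in `[m, 2 m]`.
  have key : ∀ M, m ≤ M → M ≤ 2 * m → 2 * (M ^ β / M) * a ≤ 8 * (m ^ β / m) * a := by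
    intro M h1 h2
    have hM : M ^ β ≤ 4 * m ^ β := calc
      M ^ β ≤ (2 * m) ^ β := Real.rpow_le_rpow (hm.le.trans h1) h2 hβ0.le
      _ = 2 ^ β * m ^ β := Real.mul_rpow (by norm_num) hm.le
      _ ≤ 2 ^ (2 : ℝ) * m ^ β := by
        gcongr
        norm_num
      _ = 4 * m ^ β := by norm_num
    have : M ^ β / M ≤ 4 * m ^ β / m := div_le_div₀ (by positivity) hM hm h1
    calc 2 * (M ^ β / M) * a ≤ 2 * (4 * m ^ β / m) * a := by gcongr
      _ = 8 * (m ^ β / m) * a := by ring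
  have hdiff : |y ^ β - m ^ β| ≤ 8 * (m ^ β / m) * a := by
    obtain ⟨h1, h2⟩ := abs_le.1 hym
    rcases le_total y m with h | h
    · rw [abs_sub_comm, abs_of_nonneg (sub_nonneg.2 (Real.rpow_le_rpow hy h hβ0.le))]
      refine (rpow_sub_rpow_le hβ0 hβ2 hy h hm).trans ((?_ : _ ≤ _).trans
        (key m le_rfl (by linarith)))
      exact mul_le_mul_of_nonneg_left (by linarith) (by positivity)
    · rw [abs_of_nonneg (sub_nonneg.2 (Real.rpow_le_rpow hm.le h hβ0.le))]
      refine (rpow_sub_rpow_le hβ0 hβ2 hm.le h (hm.trans_le h)).trans ((?_ : _ ≤ _).trans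
        (key y h (by linarith)))
      exact mul_le_mul_of_nonneg_left (by linarith) (by positivity)
  have e1 : (m ^ β / m) * a ≤ a ^ s * m ^ (β - s) := calc
    (m ^ β / m) * a = m ^ (β - 1) * (a ^ s * a ^ (1 - s)) := by
      rw [← Real.rpow_add ha, add_sub_cancel, Real.rpow_one, Real.rpow_sub_one hm.ne']
    _ ≤ m ^ (β - 1) * (a ^ s * m ^ (1 - s)) := by
      gcongr
    _ = a ^ s * m ^ (β - s) := by
      rw [mul_left_comm, ← Real.rpow_add hm]
      congr 2
      ring
  have e2 : a ^ β ≤ a ^ s * m ^ (β - s) := calc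
    a ^ β = a ^ s * a ^ (β - s) := by rw [← Real.rpow_add ha, add_sub_cancel]
    _ ≤ a ^ s * m ^ (β - s) := by
      gcongr
  have haβ : 0 ≤ a ^ β := by positivity
  calc |y ^ β - m ^ β - a ^ β| ≤ |y ^ β - m ^ β| + |a ^ β| := abs_sub _ _
    _ ≤ 8 * (m ^ β / m) * a + a ^ β := by rw [abs_of_nonneg haβ]; gcongr
    _ ≤ 9 * (a ^ s * m ^ (β - s)) := by linarith

lemma rpow_sub_one_le_succ_sub {γ : ℝ} (h0 : 0 < γ) (h1 : γ ≤ 1) (n : ℕ) :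
    ((n : ℝ) + 1) ^ (γ - 1) ≤ (1 / γ) * (((n : ℝ) + 1) ^ γ - (n : ℝ) ^ γ) := by
  have hn : (0 : ℝ) < n + 1 := by positivity
  have hb := rpow_one_add_le_one_add_mul_self (s := -(1 / ((n : ℝ) + 1)))
    (by rw [neg_le_neg_iff, div_le_one hn]; linarith [n.cast_nonneg (α := ℝ)]) h0.le h1
  have ht : 1 + -(1 / ((n : ℝ) + 1)) = n / (n + 1) := by field_simp; ring
  rw [ht, Real.div_rpow (by positivity) hn.le] at hb
  have hp : 0 < ((n : ℝ) + 1) ^ γ := by positivity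
  rw [div_le_iff₀ hp] at hb
  rw [Real.rpow_sub_one hn.ne', one_div, inv_mul_eq_div, le_div_iff₀ h0]
  have : (1 + γ * -(1 / ((n : ℝ) + 1))) * ((n : ℝ) + 1) ^ γ =
    ((n : ℝ) + 1) ^ γ - ((n : ℝ) + 1) ^ γ / (n + 1) * γ := by field_simp; ring
  linarith

lemma rpow_neg_one_add_le_sub {β : ℝ} (h0 : 0 < β) {n : ℕ} (hn : 0 < n) :
    ((n : ℝ) + 1) ^ (-(1 + β)) ≤ (1 / β) * ((n : ℝ) ^ (-β) - ((n : ℝ) + 1) ^ (-β)) := by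
  have hn0 : (0 : ℝ) < n := by exact_mod_cast hn
  have hn1 : (0 : ℝ) < n + 1 := by positivity
  have ht : (0 : ℝ) < n / (n + 1) := by positivity
  have hb : 1 + β / (n + 1) ≤ ((n : ℝ) / (n + 1)) ^ (-β) := by
    rw [Real.rpow_def_of_pos ht]
    have hl := Real.log_le_sub_one_of_pos ht
    have : (n : ℝ) / (n + 1) - 1 = -(1 / (n + 1)) := by field_simp; ring
    rw [this] at hl
    have he := Real.add_one_le_exp (Real.log ((n : ℝ) / (n + 1)) * -β)
    have : β / (n + 1) ≤ Real.log ((n : ℝ) / (n + 1)) * -β := by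
      have := mul_le_mul_of_nonneg_right hl h0.le
      have e : -(1 / ((n : ℝ) + 1)) * β = -(β / (n + 1)) := by ring
      linarith
    linarith
  have hp : 0 < ((n : ℝ) + 1) ^ (-β) := by positivity
  rw [Real.div_rpow hn0.le hn1.le, le_div_iff₀ hp] at hb
  have hs : ((n : ℝ) + 1) ^ (-(1 + β)) = ((n : ℝ) + 1) ^ (-β) / (n + 1) := by
    rw [← Real.rpow_sub_one hn1.ne']; congr 1; ring
  rw [hs, one_div, inv_mul_eq_div, le_div_iff₀ h0]
  have : (1 + β / ((n : ℝ) + 1)) * ((n : ℝ) + 1) ^ (-β) =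
    ((n : ℝ) + 1) ^ (-β) + ((n : ℝ) + 1) ^ (-β) / (n + 1) * β := by field_simp
  linarith

/-- The truncated moment of order `2 s` of the one-sided power kernel, up to `J`, grows at most like
`min J N ^ (2 s - β)`. -/
lemma sum_range_rpow_mul_min_rpow_le {β s : ℝ} (hβ0 : 0 < β) (hs : β < 2 * s)
    (hs' : 2 * s ≤ β + 1) {N : ℕ} (hN : 0 < N) (J : ℕ) :
    ∑ n ∈ Finset.range J, ((n : ℝ) + 1) ^ (-(1 + β)) * (min ((n : ℝ) + 1) N) ^ (2 * s) ≤
      (1 / (2 * s - β) + 1 / β) * (min (J : ℝ) N) ^ (2 * s - β) := by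
  have hγ : 0 < 2 * s - β := by linarith
  have hN0 : (0 : ℝ) < N := by exact_mod_cast hN
  -- Below the truncation the sum telescopes against `n ^ (2 s - β)`.
  have small : ∀ J ≤ N, ∑ n ∈ Finset.range J,
      ((n : ℝ) + 1) ^ (-(1 + β)) * (min ((n : ℝ) + 1) N) ^ (2 * s) ≤
      1 / (2 * s - β) * (J : ℝ) ^ (2 * s - β) := by
    intro J
    induction J with
    | zero => intro _; simp; positivity
    | succ n ih =>
      intro hn
      have hn' : (n : ℝ) + 1 ≤ N := by exact_mod_cast hn
      have hpos : (0 : ℝ) < n + 1 := by positivity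
      have h := rpow_sub_one_le_succ_sub hγ (by linarith) n
      rw [Finset.sum_range_succ, min_eq_left hn', ← Real.rpow_add hpos]
      have e : -(1 + β) + 2 * s = 2 * s - β - 1 := by ring
      rw [e]
      push_cast
      have := ih (by omega)
      linarith
  -- Above it, the sum telescopes against `- N ^ (2 s) n ^ (-β)`.
  have large : ∀ J, N ≤ J → ∑ n ∈ Finset.range J,
      ((n : ℝ) + 1) ^ (-(1 + β)) * (min ((n : ℝ) + 1) N) ^ (2 * s) ≤
      1 / (2 * s - β) * (N : ℝ) ^ (2 * s - β) +
        1 / β * ((N : ℝ) ^ (-β) - (J : ℝ) ^ (-β)) * (N : ℝ) ^ (2 * s) := by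
    intro J hJ
    induction J, hJ using Nat.le_induction with
    | base => simpa using small N le_rfl
    | succ n hn ih =>
      have hn' : (N : ℝ) ≤ n + 1 := by
        have : (N : ℝ) ≤ n := by exact_mod_cast hn
        linarith
      have h := rpow_neg_one_add_le_sub hβ0 (hN.trans_le hn)
      have h' := mul_le_mul_of_nonneg_right h (by positivity : 0 ≤ (N : ℝ) ^ (2 * s))
      rw [Finset.sum_range_succ, min_eq_right hn']
      push_cast
      linarith
  rcases le_total J N with h | h
  · rw [min_eq_left (by exact_mod_cast h)]
    refine (small J h).trans (mul_le_mul_of_nonneg_right ?_ (by positivity))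
    have : 0 < 1 / β := by positivity
    linarith
  · rw [min_eq_right (by exact_mod_cast h), add_mul]
    refine (large J h).trans ?_
    gcongr 1 / (2 * s - β) * (N : ℝ) ^ (2 * s - β) + ?_
    have e : (N : ℝ) ^ (2 * s - β) = (N : ℝ) ^ (-β) * (N : ℝ) ^ (2 * s) := by
      rw [← Real.rpow_add hN0]; congr 1; ring
    rw [e, mul_assoc]
    gcongr
    have : 0 ≤ (J : ℝ) ^ (-β) := by positivity
    linarith

/-! ### The truncated power functions -/

namespace NonlocalCD

lemma powerKernel_eq {c β : ℝ} (hβ0 : 0 < β) (j : ℤ) :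
    powerKernel c β j = c * |(j : ℝ)| ^ (-(1 + β)) := by
  unfold powerKernel
  split_ifs with h
  · rw [h, Int.cast_zero, abs_zero, Real.zero_rpow (by linarith), mul_zero]
  · rw [Real.rpow_neg (abs_nonneg _), div_eq_mul_inv]

lemma powerKernel_nonneg {c β : ℝ} (hc : 0 < c) (hβ0 : 0 < β) (j : ℤ) :
    0 ≤ powerKernel c β j := by
  rw [powerKernel_eq hβ0]
  positivity

lemma summable_powerKernel {c β : ℝ} (hβ0 : 0 < β) : Summable (powerKernel c β) := by
  simp only [funext (powerKernel_eq (c := c) hβ0)]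
  exact (Real.summable_abs_int_rpow (by linarith)).mul_left c

/-- The absolute value on `ℤ`, truncated at `N`. -/
noncomputable def truncAbs (N : ℕ) (x : ℤ) : ℝ := min |(x : ℝ)| N

lemma truncAbs_nonneg (N : ℕ) (x : ℤ) : 0 ≤ truncAbs N x :=
  le_min (abs_nonneg _) N.cast_nonneg

lemma truncAbs_zero (N : ℕ) : truncAbs N 0 = 0 := by simp [truncAbs]

lemma truncAbs_neg (N : ℕ) (x : ℤ) : truncAbs N (-x) = truncAbs N x := by simp [truncAbs]

lemma truncAbs_pos {N : ℕ} (hN : 0 < N) {x : ℤ} (hx : x ≠ 0) : 0 < truncAbs N x :=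
  lt_min (by positivity) (by exact_mod_cast hN)

lemma truncAbs_mono {N : ℕ} {x y : ℤ} (h : |x| ≤ |y|) : truncAbs N x ≤ truncAbs N y :=
  min_le_min_right _ (by exact_mod_cast h)

lemma truncAbs_add_le (N : ℕ) (x y : ℤ) : truncAbs N (x + y) ≤ truncAbs N x + truncAbs N y := by
  have h := abs_add_le (x : ℝ) y
  have hx := abs_nonneg (x : ℝ)
  have hy := abs_nonneg (y : ℝ)
  have hN := N.cast_nonneg (α := ℝ)
  unfold truncAbs
  push_cast
  grind

lemma abs_truncAbs_add_sub_le (N : ℕ) (x y : ℤ) :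
    |truncAbs N (x + y) - truncAbs N x| ≤ truncAbs N y := by
  have h1 := truncAbs_add_le N x y
  have h2 := truncAbs_add_le N (x + y) (-y)
  rw [add_neg_cancel_right, truncAbs_neg] at h2
  rw [abs_le]
  constructor <;> linarith

/-- The truncated power `min(|x|, N) ^ β`, shifted by a constant so as to vanish for
`N ≤ |x|`. -/
noncomputable def truncPow (β : ℝ) (N : ℕ) (x : ℤ) : ℝ := truncAbs N x ^ β - (N : ℝ) ^ β

lemma truncPow_sub_truncPow_zero {β : ℝ} (hβ0 : 0 < β) (N : ℕ) (x : ℤ) :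
    truncPow β N x - truncPow β N 0 = truncAbs N x ^ β := by
  unfold truncPow
  rw [truncAbs_zero, Real.zero_rpow hβ0.ne']
  ring

lemma hasCompactSupport_truncPow (β : ℝ) (N : ℕ) : HasCompactSupport (truncPow β N) := by
  refine HasCompactSupport.intro (Set.finite_Icc (-(N : ℤ)) N).isCompact fun x hx => ?_
  have h : (N : ℤ) ≤ |x| := by
    rw [Set.mem_Icc, ← abs_le, not_le] at hx
    exact hx.le
  unfold truncPow truncAbs
  rw [min_eq_right (by exact_mod_cast h), sub_self]

lemma isBoundedFun_truncPow {β : ℝ} (hβ0 : 0 < β) (N : ℕ) : IsBoundedFun (truncPow β N) := by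
  refine IsBoundedFun.sub ⟨(N : ℝ) ^ β, fun x => ?_⟩ (.const _)
  rw [abs_of_nonneg (Real.rpow_nonneg (truncAbs_nonneg N x) β)]
  exact Real.rpow_le_rpow (truncAbs_nonneg N x) (min_le_right _ _) hβ0.le

lemma nonlocalOp_truncPow {β : ℝ} (hβ0 : 0 < β) (k : ℤ → ℝ) (N : ℕ) :
    nonlocalOp k (truncPow β N) 0 = ∑' j, k j * truncAbs N j ^ β := by
  unfold nonlocalOp
  simp only [zero_add, truncPow_sub_truncPow_zero hβ0]

lemma summable_mul_truncAbs_rpow {k : ℤ → ℝ} (hk : Summable k) {p : ℝ} (hp : 0 < p) (N : ℕ) :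
    Summable fun j => k j * truncAbs N j ^ p := by
  have := summable_kernel_diff hk (isBoundedFun_truncPow hp N) 0 0
  simpa only [zero_add, truncPow_sub_truncPow_zero hp] using this

lemma secondDiff_truncPow_sq_le {β s : ℝ} (hβ0 : 0 < β) (hβ2 : β ≤ 2) (hs1 : s ≤ 1) (hsβ : s ≤ β)
    {N : ℕ} (hN : 0 < N) {j l : ℤ} (hl : l ≠ 0) (hlj : |l| ≤ |j|) :
    secondDiff (truncPow β N) 0 j l ^ 2 ≤
      81 * (truncAbs N l ^ (2 * s) * truncAbs N j ^ (2 * β - 2 * s)) := by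
  have h := abs_rpow_sub_rpow_sub_rpow_le hβ0 hβ2 hs1 hsβ (truncAbs_pos hN hl)
    (truncAbs_mono hlj) (truncAbs_nonneg N (j + l)) (abs_truncAbs_add_sub_le N j l)
  have e : secondDiff (truncPow β N) 0 j l =
      truncAbs N (j + l) ^ β - truncAbs N j ^ β - truncAbs N l ^ β := by
    rw [← truncPow_sub_truncPow_zero hβ0, ← truncPow_sub_truncPow_zero hβ0,
      ← truncPow_sub_truncPow_zero hβ0]
    unfold secondDiff
    simp only [zero_add]
    ring
  rw [e, ← sq_abs]
  refine (pow_le_pow_left₀ (abs_nonneg _) h 2).trans_eq ?_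
  rw [mul_pow, mul_pow, ← Real.rpow_mul_natCast (truncAbs_nonneg N l),
    ← Real.rpow_mul_natCast (truncAbs_nonneg N j)]
  norm_num
  congr 2 <;> ring

/-! ### Comparison of `Γ₂` with `𝓛` on truncated powers -/

lemma sum_Icc_powerKernel_mul_le {c β s : ℝ} (hc : 0 < c) (hβ0 : 0 < β) (hs : β < 2 * s)
    (hs' : 2 * s ≤ β + 1) {N : ℕ} (hN : 0 < N) (j : ℤ) :
    ∑ l ∈ Finset.Icc (-|j|) |j|, powerKernel c β l * truncAbs N l ^ (2 * s) ≤
      2 * c * (1 / (2 * s - β) + 1 / β) * truncAbs N j ^ (2 * s - β) := by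
  have heven : Function.Even fun l : ℤ => powerKernel c β l * truncAbs N l ^ (2 * s) := by
    intro l
    simp only [powerKernel_eq hβ0, truncAbs_neg, Int.cast_neg, abs_neg]
  have h := sum_range_rpow_mul_min_rpow_le hβ0 hs hs' hN j.natAbs
  have hj : |j| = (j.natAbs : ℤ) := (Int.natCast_natAbs j).symm
  have hj' : min (j.natAbs : ℝ) N = truncAbs N j := by
    unfold truncAbs
    rw [Nat.cast_natAbs, Int.cast_abs]
  rw [hj, Finset.sum_Icc_of_even_eq_range heven, Finset.sum_range_succ']
  have hterm : ∀ n : ℕ, powerKernel c β ((n + 1 : ℕ) : ℤ) *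
      truncAbs N ((n + 1 : ℕ) : ℤ) ^ (2 * s) =
      c * (((n : ℝ) + 1) ^ (-(1 + β)) * (min ((n : ℝ) + 1) N) ^ (2 * s)) := by
    intro n
    have hn : |(((n + 1 : ℕ) : ℤ) : ℝ)| = n + 1 := by
      push_cast
      exact abs_of_nonneg (by positivity)
    rw [powerKernel_eq hβ0]
    unfold truncAbs
    rw [hn, mul_assoc]
  have h0 : powerKernel c β 0 = 0 := if_pos rfl
  simp only [hterm, ← Finset.mul_sum, Nat.cast_zero, h0, zero_mul, add_zero, sub_zero]
  rw [hj'] at h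
  have := mul_le_mul_of_nonneg_left h hc.le
  rw [nsmul_eq_mul]
  push_cast
  linarith

/-- `Γ₂` of the truncated powers is controlled by the first power of `𝓛`, uniformly in the
truncation. -/
theorem exists_iteratedCarreDuChamp_truncPow_le {c β : ℝ} (hc : 0 < c) (hβ0 : 0 < β)
    (hβ2 : β < 2) : ∃ K : ℝ, ∀ N : ℕ, 0 < N →
      iteratedCarreDuChamp (nonlocalOp (powerKernel c β)) (truncPow β N) (truncPow β N) 0 ≤
        K * nonlocalOp (powerKernel c β) (truncPow β N) 0 := by
  -- An exponent `s ≤ min 1 β` with `β < 2 s` exists precisely because `0 < β < 2`.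
  obtain ⟨s, hs1, hsβ, hs⟩ : ∃ s : ℝ, s ≤ 1 ∧ s ≤ β ∧ β < 2 * s :=
    ⟨min 1 β, min_le_left _ _, min_le_right _ _, by grind⟩
  set C : ℝ := 1 / (2 * s - β) + 1 / β
  refine ⟨81 * c * C, fun N hN => ?_⟩
  set k := powerKernel c β
  set v := truncPow β N
  have hk : Summable k := summable_powerKernel hβ0
  have hk0 : ∀ j, 0 ≤ k j := powerKernel_nonneg hc hβ0
  have hv : IsBoundedFun v := isBoundedFun_truncPow hβ0 N
  rw [iteratedCarreDuChamp_nonlocalOp hk hv, nonlocalOp_truncPow hβ0]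
  let F : ℤ × ℤ → ℝ := fun p => k p.1 * k p.2 * secondDiff v 0 p.1 p.2 ^ 2
  let E : ℤ × ℤ → ℝ := fun p => if |p.2| ≤ |p.1| then F p else 0
  have hF0 : ∀ p, 0 ≤ F p := fun p =>
    mul_nonneg (mul_nonneg (hk0 _) (hk0 _)) (sq_nonneg _)
  have hF : Summable F := by
    have hD := isBoundedFun_secondDiff hv 0
    simpa only [F, pow_two] using (hD.mul hD).summable_mul hk.mul_self_prod
  have hE0 : ∀ p, 0 ≤ E p := fun p => by
    simp only [E]; split_ifs <;> simp [hF0]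
  have hEF : ∀ p, E p ≤ F p := fun p => by
    simp only [E]; split_ifs <;> simp [hF0]
  have hE : Summable E := Summable.of_nonneg_of_le hE0 hEF hF
  have hFswap : ∀ p : ℤ × ℤ, F p.swap = F p := fun p => by
    simp only [F, Prod.fst_swap, Prod.snd_swap, secondDiff_comm v 0 p.2 p.1]
    ring
  -- By symmetry it suffices to sum over the pairs whose second entry is the smaller one.
  have hsymm : ∑' p, F p ≤ 2 * ∑' p, E p := by
    have hE' : Summable fun p : ℤ × ℤ => E p.swap := hE.prod_symm
    have hEe : ∑' p : ℤ × ℤ, E p.swap = ∑' p, E p := (Equiv.prodComm ℤ ℤ).tsum_eq E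
    have h : ∑' p, F p ≤ ∑' p : ℤ × ℤ, (E p + E p.swap) := by
      refine hF.tsum_le_tsum (fun p => ?_) (hE.add hE')
      simp only [E, Prod.fst_swap, Prod.snd_swap, hFswap]
      have := hF0 p
      rcases le_total |p.2| |p.1| with h | h <;> rw [if_pos h] <;> split_ifs <;> linarith
    rw [hE.tsum_add hE', hEe] at h
    linarith
  have hinner : ∀ j, ∑' l, E (j, l) ≤ 162 * c * C * (k j * truncAbs N j ^ β) := by
    intro j
    have hsupp : ∀ l ∉ Finset.Icc (-|j|) |j|, E (j, l) = 0 := by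
      intro l hl
      rw [Finset.mem_Icc, ← abs_le] at hl
      exact if_neg hl
    rw [tsum_eq_sum hsupp]
    rcases eq_or_ne j 0 with rfl | hj
    · have h0 : k 0 = 0 := if_pos rfl
      simp [E, F, h0]
    have hterm : ∀ l ∈ Finset.Icc (-|j|) |j|, E (j, l) ≤
        81 * k j * truncAbs N j ^ (2 * β - 2 * s) * (k l * truncAbs N l ^ (2 * s)) := by
      intro l hl
      rw [Finset.mem_Icc, ← abs_le] at hl
      refine (hEF _).trans ?_
      rcases eq_or_ne l 0 with rfl | hl0
      · have h0 : k 0 = 0 := if_pos rfl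
        simp [F, h0]
      · have h := mul_le_mul_of_nonneg_left
          (secondDiff_truncPow_sq_le hβ0 hβ2.le hs1 hsβ hN hl0 hl) (mul_nonneg (hk0 j) (hk0 l))
        exact h.trans_eq (by ring)
    have hm := truncAbs_pos hN hj
    refine (Finset.sum_le_sum hterm).trans ?_
    rw [← Finset.mul_sum]
    refine (mul_le_mul_of_nonneg_left
      (sum_Icc_powerKernel_mul_le hc hβ0 hs (by linarith) hN j) ?_).trans_eq ?_
    · have := hk0 j
      positivity
    · have e : truncAbs N j ^ β =
          truncAbs N j ^ (2 * β - 2 * s) * truncAbs N j ^ (2 * s - β) := by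
        rw [← Real.rpow_add hm]; congr 1; ring
      rw [e]
      ring
  have hsum : ∑' p, E p ≤ 162 * c * C * ∑' j, k j * truncAbs N j ^ β := by
    rw [hE.tsum_prod, ← tsum_mul_left]
    exact hE.prod.tsum_le_tsum hinner ((summable_mul_truncAbs_rpow hk hβ0 N).mul_left _)
  linarith

/-- `𝓛` of the truncated power dominates a partial sum of the harmonic series. -/
lemma harmonic_le_nonlocalOp_truncPow {c β : ℝ} (hc : 0 < c) (hβ0 : 0 < β) (N : ℕ) :
    c * ∑ n ∈ Finset.range N, (1 / (n + 1) : ℝ) ≤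
      nonlocalOp (powerKernel c β) (truncPow β N) 0 := by
  rw [nonlocalOp_truncPow hβ0]
  have hinj : Set.InjOn (fun n : ℕ => (n : ℤ) + 1) (Finset.range N) :=
    fun a _ b _ h => by simpa using h
  have h := (summable_mul_truncAbs_rpow (summable_powerKernel (c := c) hβ0) hβ0 N).sum_le_tsum
    ((Finset.range N).image fun n : ℕ => (n : ℤ) + 1)
    fun j _ => mul_nonneg (powerKernel_nonneg hc hβ0 j) (Real.rpow_nonneg (truncAbs_nonneg N j) β)
  rw [Finset.sum_image hinj] at h
  refine le_trans (le_of_eq ?_) h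
  rw [Finset.mul_sum]
  refine Finset.sum_congr rfl fun n hn => ?_
  have hpos : (0 : ℝ) < n + 1 := by positivity
  have hnN : (n : ℝ) + 1 ≤ N := by exact_mod_cast Finset.mem_range.1 hn
  rw [powerKernel_eq hβ0]
  unfold truncAbs
  push_cast
  rw [abs_of_pos hpos, min_eq_left hnN, mul_assoc, ← Real.rpow_add hpos]
  have e : -(1 + β) + β = -1 := by ring
  rw [e, Real.rpow_neg_one, one_div]

end NonlocalCD

theorem mainTheorem3 (c β : ℝ) (hc : 0 < c) (hβ0 : 0 < β) (hβ2 : β < 2) :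
    ¬ ∃ d : ℝ, 0 < d ∧ ∀ v : ℤ → ℝ, HasCompactSupport v →
      NonlocalCD.iteratedCarreDuChamp
          (NonlocalCD.nonlocalOp (NonlocalCD.powerKernel c β)) v v 0 ≥
        (1 / d) * (NonlocalCD.nonlocalOp (NonlocalCD.powerKernel c β) v 0) ^ 2 := by
  rintro ⟨d, hd, h⟩
  obtain ⟨K, hK⟩ := NonlocalCD.exists_iteratedCarreDuChamp_truncPow_le hc hβ0 hβ2
  have hlim := Real.tendsto_sum_range_one_div_nat_succ_atTop.const_mul_atTop hc
  obtain ⟨N, hN, hN0⟩ := ((hlim.eventually_gt_atTop (max 0 (d * K))).and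
    (Filter.eventually_gt_atTop 0)).exists
  have hL := hN.trans_le (NonlocalCD.harmonic_le_nonlocalOp_truncPow hc hβ0 N)
  have hineq := (h _ (NonlocalCD.hasCompactSupport_truncPow β N)).le.trans (hK N hN0)
  set ℓ := NonlocalCD.nonlocalOp (NonlocalCD.powerKernel c β) (NonlocalCD.truncPow β N) 0
  obtain ⟨hpos, hlarge⟩ := max_lt_iff.1 hL
  rw [one_div, inv_mul_le_iff₀ hd] at hineq
  nlinarith [mul_lt_mul_of_pos_right hlarge hpos]
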